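/- Let $\beta>1$ be a real number and let $T_\beta(x)=\{\beta x\}$, where $\{\cdot\}$ denotes the fractional part. The Rényi expansion of unity is the sequence $d_\beta(1)=t_1t_2t_3\cdots$ with $t_i=\lfloor \beta\, T_\beta^{\,i-1}(1)\rfloor$ for $i\ge 1$. Assume that $\beta$ is a simple Parry number, i.e. $d_\beta(1)=t_1\cdots t_m$ is finite: for some $m\ge 1$, $t_m\neq 0$ and $t_i=0$ for all $i>m$. Let $$p(x)=x^m-\left(t_1x^{m-1}+t_2x^{m-2}+\dots+t_{m-1}x+t_m\right)$$ be its Parry polynomial. The $\beta$-expansion of a real number $x>0$ is obtained by the greedy algorithm: let $k\in\mathbb Z$ be such that $\beta^k\le x<\beta^{k+1}$, put $x_k=\lfloor x/\beta^k\rfloor$, $r_k=\{x/\beta^k\}$, and $x_i=\lfloor \beta r_{i+1}\rfloor$, $r_i=\{\beta r_{i+1}\}$ for $i<k$, and $x_i=0$ for $i>k$; all digits of $0$ are $0$. Let $\mathbb Z_\beta^+$ be the set of nonnegative $\beta$-integers, that is, of all real $x\ge 0$ whose $\beta$-expansion satisfies $x_i=0$ for all $i<0$. Then there is a strictly increasing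 sequence $(b_n)_{n\ge 0}$ with $b_0=0$ and $\{b_n : n\ge 0\}=\mathbb Z_\beta^+$, and for this (unique) sequence the limit $c_\beta=\lim_{n\to\infty} b_n/n$ exists and equals $$c_\beta=\frac{\beta-1}{\beta^m-1}\,p'(\beta).$$ -/

import Mathlib

open Filter Topology

noncomputable section

namespace BetaNum

/-- The `β`-transformation `T_β(x) = {βx}`. -/
def betaMap (β x : ℝ) : ℝ := Int.fract (β * x)

/-- The digits `t_i = ⌊β T_β^{i-1}(1)⌋`, `i ≥ 1`, of the Rényi expansion of unity
`d_β(1) = t_1 t_2 t_3 ⋯`. Only the indices `i ≥ 1` are meaningful. -/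
def renyiDigit (β : ℝ) (i : ℕ) : ℤ := ⌊β * (betaMap β)^[i - 1] 1⌋

/-- `β > 1` is a simple Parry number with `d_β(1) = t_1 ⋯ t_m`, `t_m ≠ 0`: the Rényi expansion of
unity is finite and its last nonzero digit has index `m ≥ 1`. -/
structure IsSimpleParry (β : ℝ) (m : ℕ) : Prop where
  one_lt : 1 < β
  one_le : 1 ≤ m
  last_ne_zero : renyiDigit β m ≠ 0
  eq_zero_of_lt : ∀ i : ℕ, m < i → renyiDigit β i = 0

/-- For `d_β(1) = t_1 ⋯ t_m`, the Parry polynomial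
`x^m - (t_1 x^{m-1} + t_2 x^{m-2} + ⋯ + t_m)`. -/
def parryPoly (β : ℝ) (m : ℕ) : Polynomial ℤ :=
  Polynomial.X ^ m -
    ∑ i ∈ Finset.Icc 1 m, Polynomial.C (renyiDigit β i) * Polynomial.X ^ (m - i)

/-- For `β > 1` and `x > 0`, the integer `k` with `β^k ≤ x < β^{k+1}`. (It is `0` for `x = 0`.) -/
def leadExp (β x : ℝ) : ℤ := ⌊Real.logb β x⌋

/-- The remainders of the greedy algorithm: with `k` the leading exponent, `greedyRem β x j` is
`r_{k-j}`, where `r_k = {x / β^k}` and `r_i = {β r_{i+1}}` for `i < k`. -/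
def greedyRem (β x : ℝ) : ℕ → ℝ
  | 0 => Int.fract (x / β ^ leadExp β x)
  | j + 1 => Int.fract (β * greedyRem β x j)

/-- The digit `x_i` (`i ∈ ℤ`) of the `β`-expansion of `x ≥ 0` given by the greedy algorithm:
`x_i = 0` for `i > k`, `x_k = ⌊x / β^k⌋`, and `x_i = ⌊β r_{i+1}⌋` for `i < k`, where `k` is the
leading exponent. All digits of `x = 0` are `0`. -/
def greedyDigit (β x : ℝ) (i : ℤ) : ℤ :=
  if leadExp β x < i then 0
  else if i = leadExp β x then ⌊x / β ^ leadExp β x⌋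
  else ⌊β * greedyRem β x (leadExp β x - (i + 1)).toNat⌋

/-- The set `ℤ_β^+` of nonnegative `β`-integers: the `x ≥ 0` whose `β`-expansion has no nonzero
digit at a negative position. -/
def nonnegBetaIntegers (β : ℝ) : Set ℝ :=
  {x : ℝ | 0 ≤ x ∧ ∀ i : ℤ, i < 0 → greedyDigit β x i = 0}

/-- `(b_n)` is the increasing enumeration of the nonnegative `β`-integers, starting at `b_0 = 0`. -/
structure IsBetaIntegerEnumeration (β : ℝ) (b : ℕ → ℝ) : Prop where
  strictMono : StrictMono b
  zero : b 0 = 0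
  range_eq : Set.range b = nonnegBetaIntegers β

end BetaNum

end

/-!
Write `T` for the `β`-transformation. A nonnegative `x < β ^ n` is a `β`-integer exactly when
`T^n (x / β ^ n) = 0` (`mem_nonnegBetaIntegers_iff`), so counting `β`-integers below `y` amounts to
counting the zeros of `T^n` in `[0, s)` with `s = y / β ^ n`. Write `A n s` for this number. Cutting
`[0, s)` into the branches of `T` gives
`A (n + 1) s = ⌊β s⌋ * A n 1 + A n (T s)` (`ncard_zeroFiber_succ`).

For `s = 1`, put `u n = A n 1 / β ^ n` and `w i = T^i 1 / β ^ i`, so that `w i - w (i + 1)` is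
`t_{i+1} / β ^ (i + 1)` and `w i = 0` for `i ≥ m`. The recursion says that the convolution
`∑_{i+j=n} w i * u j` equals the constant `C = ∑_{k<m} β ^ (-k)` once `n ≥ m - 1`
(`sum_antidiagonal_ncard_zeroFiber`), and that `u (n + 1)` is an average of the previous values
with weights `w i - w (i + 1)`. By convexity the energy `∑_{i+j=n} w i * u j ^ 2` then decreases,
each step losing at least `(w 0 - w 1) * (u (n + 1) - u n) ^ 2`. As `w 1 < 1 = w 0`,
consecutive values of `u` approach each other, and the convolution identity forces
`u n → L = C / ∑ w i` (`tendsto_of_sum_antidiagonal_eq`). No information on the conjugates of `β`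
is needed.

The recursion for general `s` contracts the error `A n s / β ^ n - L * s` by the factor `1 / β`, up
to the error at `s = 1`; so the error tends to `0` uniformly in `s`
(`eventually_abs_ncard_zeroFiber_sub_lt`), and the number of `β`-integers below `y` is
asymptotic to `L * y`. Taking `y = b n` gives `n / b n → L`. Finally `p'(β) = β ^ (m - 1) * ∑ w i`
by Horner's scheme (`aeval_derivative_parryPoly`), which identifies `1 / L` with the stated
constant.
-/

namespace BetaNum

open Finset.HasAntidiagonal (antidiagonal mem_antidiagonal)

/-! ### The `β`-transformation -/

lemma betaMap_nonneg (β x : ℝ) : 0 ≤ betaMap β x := Int.fract_nonneg _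

lemma betaMap_lt_one (β x : ℝ) : betaMap β x < 1 := Int.fract_lt_one _

lemma floor_add_betaMap (β x : ℝ) : (⌊β * x⌋ : ℝ) + betaMap β x = β * x :=
  Int.floor_add_fract _

lemma iterate_betaMap_zero (β : ℝ) (n : ℕ) : (betaMap β)^[n] 0 = 0 :=
  Function.iterate_fixed (by simp [betaMap]) n

lemma iterate_betaMap_nonneg (β : ℝ) {x : ℝ} (hx : 0 ≤ x) (n : ℕ) : 0 ≤ (betaMap β)^[n] x := by
  cases n with
  | zero => simpa using hx
  | succ n => rw [Function.iterate_succ_apply']; exact betaMap_nonneg _ _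

/-- A point all of whose digits vanish is `0`: otherwise its orbit would grow like `β ^ j`. -/
lemma eq_zero_of_forall_floor_eq_zero {β y : ℝ} (hβ : 1 < β) (hy : 0 ≤ y)
    (h : ∀ j, ⌊β * (betaMap β)^[j] y⌋ = 0) : y = 0 := by
  have key : ∀ j, (betaMap β)^[j] y = β ^ j * y := by
    intro j
    induction j with
    | zero => simp
    | succ j ih =>
      have h1 := floor_add_betaMap β ((betaMap β)^[j] y)
      rw [h j, Int.cast_zero, zero_add] at h1
      rw [Function.iterate_succ_apply', h1, ih]; ring
  by_contra hne
  have hpos : 0 < y := lt_of_le_of_ne hy (Ne.symm hne)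
  obtain ⟨n, hn⟩ := pow_unbounded_of_one_lt (1 / y) hβ
  have h1 := (Int.floor_eq_zero_iff.1 (h n)).2
  rw [key, ← mul_assoc, ← pow_succ'] at h1
  have h2 : β ^ n ≤ β ^ (n + 1) := pow_le_pow_right₀ hβ.le (Nat.le_succ n)
  rw [div_lt_iff₀ hpos] at hn
  nlinarith

/-- Leading zeros of an expansion are shifted away by the `β`-transformation. -/
lemma iterate_betaMap_div_pow {β x : ℝ} (hβ : 1 < β) (hx : 0 ≤ x) {k : ℕ} (hk : x < β ^ k)
    (j : ℕ) : (betaMap β)^[j] (x / β ^ (k + j)) = x / β ^ k := by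
  have hβ0 : 0 < β := by linarith
  induction j with
  | zero => simp
  | succ j ih =>
    have h1 : β * (x / β ^ (k + (j + 1))) = x / β ^ (k + j) := by
      rw [← add_assoc, pow_succ]; field_simp
    have h2 : betaMap β (x / β ^ (k + (j + 1))) = x / β ^ (k + j) := by
      rw [betaMap, h1, Int.fract_eq_self]
      refine ⟨by positivity, (div_lt_one (by positivity)).2 (hk.trans_le ?_)⟩
      exact pow_le_pow_right₀ hβ.le (by omega)
    rw [Function.iterate_succ_apply, h2, ih]

/-! ### `β`-integers as zeros of iterates -/

lemma greedyRem_eq_iterate (β x : ℝ) (j : ℕ) :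
    greedyRem β x j = (betaMap β)^[j] (Int.fract (x / β ^ leadExp β x)) := by
  induction j with
  | zero => rfl
  | succ j ih => rw [Function.iterate_succ_apply', ← ih]; rfl

lemma zpow_leadExp_le {β x : ℝ} (hβ : 1 < β) (hx : 0 < x) : β ^ leadExp β x ≤ x := by
  rw [← Real.rpow_intCast, ← Real.le_logb_iff_rpow_le hβ hx]
  exact Int.floor_le _

lemma lt_zpow_leadExp_add_one {β x : ℝ} (hβ : 1 < β) (hx : 0 < x) :
    x < β ^ (leadExp β x + 1) := by
  rw [← Real.rpow_intCast, ← Real.logb_lt_iff_lt_rpow hβ hx]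
  push_cast
  exact Int.lt_floor_add_one _

lemma zero_mem_nonnegBetaIntegers (β : ℝ) : (0 : ℝ) ∈ nonnegBetaIntegers β := by
  refine ⟨le_rfl, fun i hi => ?_⟩
  have h : leadExp β 0 = 0 := by simp [leadExp]
  rw [greedyDigit, h, if_neg (by omega), if_neg (by omega), greedyRem_eq_iterate]
  simp [iterate_betaMap_zero]

lemma mem_nonnegBetaIntegers_iff {β x : ℝ} (hβ : 1 < β) (hx : 0 ≤ x) {n : ℕ} (hn : x < β ^ n) :
    x ∈ nonnegBetaIntegers β ↔ (betaMap β)^[n] (x / β ^ n) = 0 := by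
  have hβ0 : 0 < β := by linarith
  rcases hx.eq_or_lt with rfl | hpos
  · simp [zero_mem_nonnegBetaIntegers, iterate_betaMap_zero]
  have hle := zpow_leadExp_le hβ hpos
  have hlt := lt_zpow_leadExp_add_one hβ hpos
  -- If the leading exponent is negative, both sides are false: `x` has a nonzero digit there, and
  -- the iterate is `x` itself.
  rcases lt_or_ge (leadExp β x) 0 with hk | hk
  · have hx1 : x < 1 := hlt.trans_le (by
      simpa using zpow_le_zpow_right₀ hβ.le (show leadExp β x + 1 ≤ 0 by omega))
    have h1 := iterate_betaMap_div_pow hβ hx (k := 0) (by simpa using hx1) n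
    rw [zero_add, pow_zero, div_one] at h1
    rw [h1]
    refine ⟨fun h => ?_, fun h => absurd h hpos.ne'⟩
    have h2 := h.2 _ hk
    rw [greedyDigit, if_neg (lt_irrefl _), if_pos rfl, Int.floor_eq_zero_iff] at h2
    exact absurd h2.2 (not_lt.2 ((one_le_div (by positivity)).2 hle))
  · obtain ⟨k, hk'⟩ := Int.eq_ofNat_of_zero_le hk
    rw [hk'] at hle hlt
    have hlt' : x < β ^ (k + 1) := by exact_mod_cast hlt
    have hle' : β ^ k ≤ x := by exact_mod_cast hle
    have hkn : k + 1 ≤ n := by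
      have := (pow_lt_pow_iff_right₀ hβ).1 (hle'.trans_lt hn)
      omega
    -- The iterate is the remainder at position `0`, the fractional part of the expansion.
    have hrem : (betaMap β)^[n] (x / β ^ n) = greedyRem β x k := by
      obtain ⟨j, rfl⟩ := Nat.exists_eq_add_of_le hkn
      rw [Function.iterate_add_apply, iterate_betaMap_div_pow hβ hx hlt',
        Function.iterate_succ_apply, greedyRem_eq_iterate, hk']
      have : β * (x / β ^ (k + 1)) = x / β ^ (k : ℤ) := by
        rw [zpow_natCast, pow_succ]
        field_simp
      rw [betaMap, this]
    rw [hrem]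
    have hdig : ∀ j : ℕ, greedyDigit β x (-(j : ℤ) - 1) =
        ⌊β * (betaMap β)^[j] (greedyRem β x k)⌋ := by
      intro j
      rw [greedyDigit, if_neg (by omega), if_neg (by omega), hk', greedyRem_eq_iterate β x k,
        ← Function.iterate_add_apply, ← greedyRem_eq_iterate]
      congr 3
      omega
    constructor
    · intro h
      refine eq_zero_of_forall_floor_eq_zero hβ ?_ fun j => ?_
      · rw [greedyRem_eq_iterate]
        exact iterate_betaMap_nonneg β (Int.fract_nonneg _) k
      · rw [← hdig]
        exact h.2 _ (by omega)
    · intro h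
      refine ⟨hx, fun i hi => ?_⟩
      obtain ⟨j, rfl⟩ : ∃ j : ℕ, i = -(j : ℤ) - 1 := ⟨(-i - 1).toNat, by omega⟩
      rw [hdig, h, iterate_betaMap_zero]
      simp

/-! ### Counting zeros of iterates -/

/-- The points of `[0, s)` sent to `0` by the `n`-th iterate of the `β`-transformation. -/
def zeroFiber (β : ℝ) (n : ℕ) (s : ℝ) : Set ℝ :=
  {z | 0 ≤ z ∧ z < s ∧ (betaMap β)^[n] z = 0}

lemma zeroFiber_zero_right (β : ℝ) (n : ℕ) : zeroFiber β n 0 = ∅ := by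
  ext z
  simp only [zeroFiber, Set.mem_ofPred_eq, Set.mem_empty_iff_false, iff_false]
  rintro ⟨h1, h2, -⟩
  linarith

lemma zeroFiber_zero_left (β : ℝ) {s : ℝ} (hs : 0 < s) : zeroFiber β 0 s = {0} := by
  ext z
  simp only [zeroFiber, Set.mem_ofPred_eq, Set.mem_singleton_iff, Function.iterate_zero, id]
  exact ⟨fun h => h.2.2, fun h => by simp [h, hs]⟩

lemma zeroFiber_mono (β : ℝ) (n : ℕ) {s t : ℝ} (h : s ≤ t) : zeroFiber β n s ⊆ zeroFiber β n t :=
  fun _ hz => ⟨hz.1, hz.2.1.trans_le h, hz.2.2⟩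

/-- The zeros of `T^n ∘ fract` in `[0, d + f)` form `d` translates of those in `[0, 1)` and one of
those in `[0, f)`. -/
lemma encard_periodic_zeroFiber (β : ℝ) (n d : ℕ) {f : ℝ} (hf0 : 0 ≤ f) (hf1 : f < 1) :
    {w : ℝ | 0 ≤ w ∧ w < d + f ∧ (betaMap β)^[n] (Int.fract w) = 0}.encard =
      d * (zeroFiber β n 1).encard + (zeroFiber β n f).encard := by
  induction d with
  | zero =>
    simp only [Nat.cast_zero, zero_add, zero_mul]
    congr 1
    ext w
    simp only [zeroFiber, Set.mem_ofPred_eq]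
    refine and_congr_right fun h0 => and_congr_right fun h1 => ?_
    rw [Int.fract_eq_self.2 ⟨h0, h1.trans hf1⟩]
  | succ d ih =>
    have hset : {w : ℝ | 0 ≤ w ∧ w < (d + 1 : ℕ) + f ∧ (betaMap β)^[n] (Int.fract w) = 0} =
        zeroFiber β n 1 ∪ (fun w : ℝ => w + 1) ''
          {w : ℝ | 0 ≤ w ∧ w < d + f ∧ (betaMap β)^[n] (Int.fract w) = 0} := by
      ext w
      simp only [zeroFiber, Set.mem_ofPred_eq, Set.mem_union, Set.mem_image]
      constructor
      · rintro ⟨h0, h1, h2⟩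
        rcases lt_or_ge w 1 with hw | hw
        · left
          rw [Int.fract_eq_self.2 ⟨h0, hw⟩] at h2
          exact ⟨h0, hw, h2⟩
        · right
          refine ⟨w - 1, ⟨by linarith, ?_, ?_⟩, by ring⟩
          · push_cast at h1; linarith
          · rwa [Int.fract_sub_one]
      · rintro (⟨h0, h1, h2⟩ | ⟨v, ⟨h0, h1, h2⟩, rfl⟩)
        · refine ⟨h0, ?_, ?_⟩
          · push_cast
            have : (0 : ℝ) ≤ d := Nat.cast_nonneg d
            linarith
          · rwa [Int.fract_eq_self.2 ⟨h0, h1⟩]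
        · refine ⟨by linarith, ?_, ?_⟩
          · push_cast; linarith
          · rwa [Int.fract_add_one]
    have hdisj : Disjoint (zeroFiber β n 1) ((fun w : ℝ => w + 1) ''
          {w : ℝ | 0 ≤ w ∧ w < d + f ∧ (betaMap β)^[n] (Int.fract w) = 0}) := by
      rw [Set.disjoint_left]
      rintro _ ⟨-, h1, -⟩ ⟨v, ⟨h0, -⟩, rfl⟩
      simp only at h1
      linarith
    rw [hset, Set.encard_union_eq hdisj,
      Function.Injective.encard_image (add_left_injective (1 : ℝ)), ih]
    push_cast
    ring

/-- The branches of the `β`-transformation: scaling by `β` carries `[0, s)` to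
`[0, ⌊β s⌋ + T s)`. -/
lemma encard_zeroFiber_succ {β : ℝ} (hβ : 1 < β) (n : ℕ) {s : ℝ} (hs : 0 ≤ s) :
    (zeroFiber β (n + 1) s).encard =
      ⌊β * s⌋₊ * (zeroFiber β n 1).encard + (zeroFiber β n (betaMap β s)).encard := by
  have hβ0 : 0 < β := by linarith
  have hfl : (⌊β * s⌋₊ : ℝ) + betaMap β s = β * s := by
    rw [natCast_floor_eq_intCast_floor (by positivity)]
    exact floor_add_betaMap β s
  rw [← encard_periodic_zeroFiber β n _ (betaMap_nonneg β s) (betaMap_lt_one β s), hfl,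
    ← Function.Injective.encard_image (mul_right_injective₀ hβ0.ne')]
  congr 1
  ext w
  simp only [zeroFiber, Set.mem_ofPred_eq, Set.mem_image, Function.iterate_succ_apply]
  constructor
  · rintro ⟨z, ⟨h0, h1, h2⟩, rfl⟩
    exact ⟨by positivity, by gcongr, h2⟩
  · rintro ⟨h0, h1, h2⟩
    have hw : β * (w / β) = w := by field_simp
    refine ⟨w / β, ⟨by positivity, ?_, ?_⟩, hw⟩
    · rwa [div_lt_iff₀' hβ0]
    · rwa [betaMap, hw]

lemma finite_zeroFiber {β : ℝ} (hβ : 1 < β) (n : ℕ) {s : ℝ} (hs : 0 ≤ s) :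
    (zeroFiber β n s).Finite := by
  induction n generalizing s with
  | zero =>
    refine (Set.finite_singleton (0 : ℝ)).subset fun z hz => ?_
    simpa using hz.2.2
  | succ n ih =>
    rw [← Set.encard_lt_top_iff, encard_zeroFiber_succ hβ n hs,
      ← (ih zero_le_one).cast_ncard_eq, ← (ih (betaMap_nonneg β s)).cast_ncard_eq]
    exact_mod_cast ENat.natCast_lt_top _

lemma ncard_zeroFiber_succ {β : ℝ} (hβ : 1 < β) (n : ℕ) {s : ℝ} (hs : 0 ≤ s) :
    ((zeroFiber β (n + 1) s).ncard : ℝ) =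
      ⌊β * s⌋ * (zeroFiber β n 1).ncard + (zeroFiber β n (betaMap β s)).ncard := by
  have h := encard_zeroFiber_succ hβ n hs
  rw [← (finite_zeroFiber hβ _ hs).cast_ncard_eq,
    ← (finite_zeroFiber hβ n zero_le_one).cast_ncard_eq,
    ← (finite_zeroFiber hβ n (betaMap_nonneg β s)).cast_ncard_eq] at h
  rw [← natCast_floor_eq_intCast_floor (by positivity)]
  exact_mod_cast h

lemma ncard_zeroFiber_eq_sum {β : ℝ} (hβ : 1 < β) (n : ℕ) {s : ℝ} (hs : 0 ≤ s) :
    ((zeroFiber β (n + 1) s).ncard : ℝ) =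
      ∑ q ∈ antidiagonal n, (⌊β * (betaMap β)^[q.1] s⌋ : ℝ) * (zeroFiber β q.2 1).ncard +
        (zeroFiber β 0 ((betaMap β)^[n + 1] s)).ncard := by
  induction n generalizing s with
  | zero => simp [ncard_zeroFiber_succ hβ 0 hs]
  | succ n ih =>
    rw [ncard_zeroFiber_succ hβ _ hs, ih (betaMap_nonneg β s), Finset.Nat.sum_antidiagonal_succ]
    simp only [Function.iterate_succ_apply, Function.iterate_zero, id]
    ring

/-! ### A renewal theorem -/

/-- If the convolution of `u` with a nonincreasing, finitely supported sequence `w` satisfying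
`w 1 < w 0 = 1` is eventually constant, then `u` converges, and to the only possible limit. The
inequality `w 1 < 1` is the aperiodicity condition of renewal theory. -/
lemma tendsto_of_sum_antidiagonal_eq {w u : ℕ → ℝ} {m : ℕ} {C : ℝ} (hw0 : w 0 = 1)
    (hw1 : w 1 < 1) (hanti : ∀ i, w (i + 1) ≤ w i) (hwm : ∀ i, m ≤ i → w i = 0)
    (hC : ∀ n, m ≤ n → ∑ q ∈ antidiagonal n, w q.1 * u q.2 = C) :
    Tendsto u atTop (𝓝 (C / ∑ i ∈ Finset.range m, w i)) := by
  have hw_nonneg : ∀ i, 0 ≤ w i := fun i => by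
    rw [← hwm (max i m) (le_max_right _ _)]
    exact antitone_nat_of_succ_le hanti (le_max_left _ _)
  have hm : 0 < m := by
    by_contra h
    have := hwm 0 (by omega)
    linarith
  have hdiff : ∀ (v : ℕ → ℝ) (n : ℕ), ∑ q ∈ antidiagonal (n + 1), w q.1 * v q.2 =
      ∑ q ∈ antidiagonal n, w q.1 * v q.2 +
        (v (n + 1) - ∑ q ∈ antidiagonal n, (w q.1 - w (q.1 + 1)) * v q.2) := by
    intro v n
    rw [Finset.Nat.sum_antidiagonal_succ]
    simp only [hw0, sub_mul, Finset.sum_sub_distrib]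
    ring
  have hone : ∀ n, m ≤ n → ∑ q ∈ antidiagonal n, (w q.1 - w (q.1 + 1)) = 1 := by
    intro n hn
    rw [Finset.Nat.sum_antidiagonal_eq_sum_range_succ_mk, Finset.sum_range_sub', hw0,
      hwm _ (by omega), sub_zero]
  have hu : ∀ n, m ≤ n → ∑ q ∈ antidiagonal n, (w q.1 - w (q.1 + 1)) * u q.2 = u (n + 1) := by
    intro n hn
    have := hdiff u n
    rw [hC n hn, hC _ (by omega)] at this
    linarith
  -- The energy decreases by the variance of the averaged values about their mean `u (n + 1)`.
  set Q : ℕ → ℝ := fun n => ∑ q ∈ antidiagonal n, w q.1 * u q.2 ^ 2 with hQ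
  have hQ0 : ∀ n, 0 ≤ Q n := fun n =>
    Finset.sum_nonneg fun q _ => mul_nonneg (hw_nonneg _) (sq_nonneg _)
  have hQstep : ∀ n, m ≤ n → (1 - w 1) * (u (n + 1) - u n) ^ 2 ≤ Q n - Q (n + 1) := by
    intro n hn
    have h1 : Q n - Q (n + 1) =
        ∑ q ∈ antidiagonal n, (w q.1 - w (q.1 + 1)) * (u (n + 1) - u q.2) ^ 2 := by
      have h2 : ∑ q ∈ antidiagonal n, (w q.1 - w (q.1 + 1)) * (u (n + 1) - u q.2) ^ 2 =
          u (n + 1) ^ 2 * ∑ q ∈ antidiagonal n, (w q.1 - w (q.1 + 1)) -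
          2 * u (n + 1) * ∑ q ∈ antidiagonal n, (w q.1 - w (q.1 + 1)) * u q.2 +
          ∑ q ∈ antidiagonal n, (w q.1 - w (q.1 + 1)) * u q.2 ^ 2 := by
        rw [Finset.mul_sum, Finset.mul_sum, ← Finset.sum_sub_distrib, ← Finset.sum_add_distrib]
        exact Finset.sum_congr rfl fun q _ => by ring
      rw [h2, hone n hn, hu n hn]
      have := hdiff (fun n => u n ^ 2) n
      simp only [hQ]
      linarith
    rw [h1]
    have := Finset.single_le_sum
      (f := fun q : ℕ × ℕ => (w q.1 - w (q.1 + 1)) * (u (n + 1) - u q.2) ^ 2)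
      (s := antidiagonal n) (fun q _ => mul_nonneg (sub_nonneg.2 (hanti _)) (sq_nonneg _))
      (mem_antidiagonal.2 (zero_add n) : (0, n) ∈ antidiagonal n)
    simpa [hw0] using this
  have hw1' : 0 < 1 - w 1 := by linarith
  have hQanti : Antitone fun k => Q (k + m) := antitone_nat_of_succ_le fun k => by
    have h := hQstep (k + m) (by omega)
    have h2 : 0 ≤ (1 - w 1) * (u (k + m + 1) - u (k + m)) ^ 2 := by positivity
    rw [show k + 1 + m = k + m + 1 by ring]
    linarith
  have hQlim := tendsto_atTop_ciInf hQanti ⟨0, by rintro _ ⟨k, rfl⟩; exact hQ0 _⟩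
  have hstep : Tendsto (fun n => u (n + 1) - u n) atTop (𝓝 0) := by
    have h0 : Tendsto (fun k => (Q (k + m) - Q (k + 1 + m)) / (1 - w 1)) atTop (𝓝 0) := by
      have := (hQlim.sub (hQlim.comp (tendsto_add_atTop_nat 1))).div_const (1 - w 1)
      simpa using this
    have h1 : Tendsto (fun k => (u (k + m + 1) - u (k + m)) ^ 2) atTop (𝓝 0) := by
      refine squeeze_zero (fun k => sq_nonneg _) (fun k => ?_) h0
      rw [le_div_iff₀ hw1', show k + 1 + m = k + m + 1 by ring, mul_comm]
      exact hQstep _ (by omega)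
    have h2 : Tendsto (fun k => |u (k + m + 1) - u (k + m)|) atTop (𝓝 0) := by
      have := h1.sqrt
      simpa [Real.sqrt_sq_eq_abs] using this
    exact (tendsto_add_atTop_iff_nat (f := fun n => u (n + 1) - u n) m).1
      ((tendsto_zero_iff_abs_tendsto_zero _).2 h2)
  -- All terms of the convolution are now asymptotically equal, so the limit can be read off it.
  have hshift : ∀ i, Tendsto (fun n => u (n + i) - u n) atTop (𝓝 0) := by
    intro i
    induction i with
    | zero => simp
    | succ i ih =>
      have := (hstep.comp (tendsto_add_atTop_nat i)).add ih
      rw [add_zero] at this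
      refine this.congr fun n => ?_
      simp only [Function.comp]
      rw [add_assoc]
      ring
  set W : ℝ := ∑ i ∈ Finset.range m, w i with hW
  have hWpos : 0 < W := by
    have : w 0 ≤ W := Finset.single_le_sum (fun i _ => hw_nonneg i) (Finset.mem_range.2 hm)
    linarith
  have hsum : ∀ k, C = W * u k + ∑ i ∈ Finset.range m, w i * (u (k + (m - i)) - u k) := by
    intro k
    rw [← hC (k + m) (by omega), Finset.Nat.sum_antidiagonal_eq_sum_range_succ_mk,
      ← Finset.sum_subset (s₁ := Finset.range m) (Finset.range_subset_range.2 (by omega))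
        (fun i _ hi => by rw [hwm i (by simpa using hi), zero_mul]),
      hW, Finset.sum_mul, ← Finset.sum_add_distrib]
    refine Finset.sum_congr rfl fun i hi => ?_
    have := Finset.mem_range.1 hi
    rw [show k + m - i = k + (m - i) by omega]
    ring
  have hrem : Tendsto (fun k => ∑ i ∈ Finset.range m, w i * (u (k + (m - i)) - u k)) atTop
      (𝓝 0) := by
    have := tendsto_finsetSum (Finset.range m)
      (fun i _ => (hshift (m - i)).const_mul (w i))
    simpa using this
  have hfin := (hrem.const_sub C).div_const W
  rw [sub_zero] at hfin
  refine hfin.congr fun k => ?_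
  rw [div_eq_iff hWpos.ne']
  linarith [hsum k]

/-! ### The number of zeros in the unit interval -/

lemma iterate_betaMap_one_eq_zero {β : ℝ} {m : ℕ} (hβ : IsSimpleParry β m) {n : ℕ}
    (hn : m ≤ n) : (betaMap β)^[n] 1 = 0 := by
  have hm : (betaMap β)^[m] 1 = 0 := by
    refine eq_zero_of_forall_floor_eq_zero hβ.one_lt
      (iterate_betaMap_nonneg β zero_le_one m) fun j => ?_
    rw [← Function.iterate_add_apply]
    exact hβ.eq_zero_of_lt (j + m + 1) (by omega)
  obtain ⟨j, rfl⟩ := Nat.exists_eq_add_of_le' hn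
  rw [Function.iterate_add_apply, hm, iterate_betaMap_zero]

lemma iterate_betaMap_one_pos {β : ℝ} {m : ℕ} (hβ : IsSimpleParry β m) {n : ℕ}
    (hn : n < m) : 0 < (betaMap β)^[n] 1 := by
  refine lt_of_le_of_ne (iterate_betaMap_nonneg β zero_le_one n) fun h => hβ.last_ne_zero ?_
  obtain ⟨j, hj⟩ := Nat.exists_eq_add_of_le' (Nat.le_sub_one_of_lt hn)
  rw [renyiDigit, hj, Function.iterate_add_apply, ← h, iterate_betaMap_zero]
  simp

/-- The renewal equation in summed form. The summand `β ^ (-k)` is the count at level `0` in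
`[0, T^k 1)`, which is `1` or `0` according to whether `T^k 1` is positive or not. -/
lemma sum_antidiagonal_ncard_zeroFiber {β : ℝ} {m : ℕ} (hβ : IsSimpleParry β m) (n : ℕ) :
    ∑ q ∈ antidiagonal n, ((betaMap β)^[q.1] 1 / β ^ q.1) * ((zeroFiber β q.2 1).ncard / β ^ q.2) =
      ∑ k ∈ Finset.range (n + 1), if k < m then (β⁻¹) ^ k else 0 := by
  have hβ0 : 0 < β := by linarith [hβ.one_lt]
  have hcount : ∀ k, ((zeroFiber β 0 ((betaMap β)^[k] 1)).ncard : ℝ) =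
      if k < m then 1 else 0 := by
    intro k
    split_ifs with h
    · simp [zeroFiber_zero_left β (iterate_betaMap_one_pos hβ h)]
    · simp [iterate_betaMap_one_eq_zero hβ (not_lt.1 h), zeroFiber_zero_right]
  have hdiv : ∀ n, ∑ q ∈ antidiagonal n,
      ((betaMap β)^[q.1] 1 / β ^ q.1) * ((zeroFiber β q.2 1).ncard / β ^ q.2) =
      (∑ q ∈ antidiagonal n, (betaMap β)^[q.1] 1 * (zeroFiber β q.2 1).ncard) / β ^ n := by
    intro n
    rw [Finset.sum_div]
    refine Finset.sum_congr rfl fun q hq => ?_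
    rw [← mem_antidiagonal.1 hq, pow_add, div_mul_div_comm]
  induction n with
  | zero =>
    have h0 : 0 < m := hβ.one_le
    simp [zeroFiber_zero_left, h0]
  | succ n ih =>
    rw [Finset.sum_range_succ, ← ih, hdiv, hdiv, Finset.Nat.sum_antidiagonal_succ]
    simp only [Function.iterate_zero, id]
    rw [ncard_zeroFiber_eq_sum hβ.one_lt n zero_le_one, hcount]
    -- Digit by digit, `t_{i+1} + T^{i+1} 1 = β * T^i 1`.
    have h1 : ∑ q ∈ antidiagonal n, (⌊β * (betaMap β)^[q.1] 1⌋ : ℝ) * (zeroFiber β q.2 1).ncard +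
        ∑ q ∈ antidiagonal n, (betaMap β)^[q.1 + 1] 1 * ((zeroFiber β q.2 1).ncard : ℝ) =
        β * ∑ q ∈ antidiagonal n, (betaMap β)^[q.1] 1 * ((zeroFiber β q.2 1).ncard : ℝ) := by
      rw [Finset.mul_sum, ← Finset.sum_add_distrib]
      refine Finset.sum_congr rfl fun q _ => ?_
      rw [Function.iterate_succ_apply', ← add_mul, floor_add_betaMap, mul_assoc]
    have h2 : ∀ a b c d : ℝ, a + c = β * d →
        (1 * (a + b) + c) / β ^ (n + 1) = d / β ^ n + b * (β⁻¹) ^ (n + 1) := by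
      intro a b c d h
      rw [show 1 * (a + b) + c = β * d + b by linarith, inv_pow, pow_succ]
      field_simp
    rw [h2 _ _ _ _ h1]
    split_ifs <;> simp

/-! ### The Parry polynomial and its derivative at `β` -/

/-- The partial Parry polynomials follow Horner's scheme. -/
lemma parryPoly_succ (β : ℝ) (k : ℕ) :
    parryPoly β (k + 1) =
      Polynomial.X * parryPoly β k - Polynomial.C (renyiDigit β (k + 1)) := by
  rw [parryPoly, parryPoly, Finset.sum_Icc_succ_top (by omega), mul_sub, Finset.mul_sum]
  have : ∀ i ∈ Finset.Icc 1 k,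
      Polynomial.X * (Polynomial.C (renyiDigit β i) * (Polynomial.X : Polynomial ℤ) ^ (k - i)) =
      Polynomial.C (renyiDigit β i) * Polynomial.X ^ (k + 1 - i) := by
    intro i hi
    rw [show k + 1 - i = k - i + 1 by have := Finset.mem_Icc.1 hi; omega, pow_succ]
    ring
  rw [Finset.sum_congr rfl this, Nat.sub_self]
  ring

lemma aeval_parryPoly (β : ℝ) (k : ℕ) :
    Polynomial.aeval β (parryPoly β k) = (betaMap β)^[k] 1 := by
  induction k with
  | zero => simp [parryPoly]
  | succ k ih =>
    rw [parryPoly_succ, map_sub, map_mul, ih, Polynomial.aeval_X, Polynomial.aeval_C,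
      Function.iterate_succ_apply', algebraMap_int_eq, eq_intCast, sub_eq_iff_eq_add',
      ← floor_add_betaMap]
    rfl

lemma aeval_derivative_parryPoly {β : ℝ} (hβ : β ≠ 0) (k : ℕ) :
    Polynomial.aeval β (Polynomial.derivative (parryPoly β k)) * β =
      β ^ k * ∑ i ∈ Finset.range k, (betaMap β)^[i] 1 / β ^ i := by
  induction k with
  | zero => simp [parryPoly]
  | succ k ih =>
    rw [parryPoly_succ, Finset.sum_range_succ, mul_add, pow_succ', mul_assoc, ← ih]
    simp only [map_sub, Polynomial.derivative_mul, Polynomial.derivative_X,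
      Polynomial.derivative_C, map_add, map_mul, map_one, map_zero, Polynomial.aeval_X,
      aeval_parryPoly]
    field_simp
    ring

/-- The asymptotic number of nonnegative `β`-integers per unit length, in the form in which the
renewal theorem produces it. It is meaningful when `d_β(1)` has length `m`. -/
noncomputable def density (β : ℝ) (m : ℕ) : ℝ :=
  (∑ k ∈ Finset.range m, (β⁻¹) ^ k) / ∑ i ∈ Finset.range m, (betaMap β)^[i] 1 / β ^ i

lemma density_pos {β : ℝ} {m : ℕ} (hβ : IsSimpleParry β m) : 0 < density β m := by
  have hβ0 : 0 < β := by linarith [hβ.one_lt]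
  have hne : (Finset.range m).Nonempty := Finset.nonempty_range_iff.2 (by have := hβ.one_le; omega)
  refine div_pos (Finset.sum_pos (fun k _ => by positivity) hne)
    (Finset.sum_pos (fun i hi => ?_) hne)
  have := iterate_betaMap_one_pos hβ (Finset.mem_range.1 hi)
  positivity

lemma inv_density {β : ℝ} {m : ℕ} (hβ : IsSimpleParry β m) :
    (density β m)⁻¹ = (β - 1) / (β ^ m - 1) *
      Polynomial.aeval β (Polynomial.derivative (parryPoly β m)) := by
  have hβ1 := hβ.one_lt
  have hβ0 : 0 < β := by linarith
  have hpow : 1 < β ^ m := one_lt_pow₀ hβ1 (by have := hβ.one_le; omega)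
  have hgeom : ∑ k ∈ Finset.range m, (β⁻¹) ^ k = (β ^ m - 1) * β / (β ^ m * (β - 1)) := by
    have h1 : β⁻¹ - 1 ≠ 0 := by
      rw [sub_ne_zero]; exact (inv_lt_one_of_one_lt₀ hβ1).ne
    rw [geom_sum_eq (inv_lt_one_of_one_lt₀ hβ1).ne, inv_pow, div_eq_div_iff h1
      (mul_ne_zero (by positivity) (by linarith))]
    field_simp
    ring
  have hder := aeval_derivative_parryPoly hβ0.ne' m
  rw [density, inv_div, hgeom]
  have h1 : β ^ m - 1 ≠ 0 := by linarith
  have h2 : β - 1 ≠ 0 := by linarith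
  have h3 : ∑ i ∈ Finset.range m, (betaMap β)^[i] 1 / β ^ i =
      Polynomial.aeval β (Polynomial.derivative (parryPoly β m)) * β / β ^ m := by
    rw [hder]; field_simp
  rw [h3]
  field_simp

lemma tendsto_ncard_zeroFiber_one {β : ℝ} {m : ℕ} (hβ : IsSimpleParry β m) :
    Tendsto (fun n => ((zeroFiber β n 1).ncard : ℝ) / β ^ n) atTop (𝓝 (density β m)) := by
  have hβ1 := hβ.one_lt
  have hβ0 : 0 < β := by linarith
  refine tendsto_of_sum_antidiagonal_eq (w := fun i => (betaMap β)^[i] 1 / β ^ i) (by simp) ?_ ?_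
    ?_ ?_
  · simp only [Function.iterate_one, pow_one]
    rw [div_lt_one hβ0]
    exact (betaMap_lt_one β 1).trans hβ1
  · intro i
    rw [Function.iterate_succ_apply', div_le_div_iff₀ (by positivity) (by positivity)]
    have h1 := floor_add_betaMap β ((betaMap β)^[i] 1)
    have h2 : (0 : ℝ) ≤ ⌊β * (betaMap β)^[i] 1⌋ := by
      exact_mod_cast Int.floor_nonneg.2
        (mul_nonneg hβ0.le (iterate_betaMap_nonneg β zero_le_one i))
    calc betaMap β ((betaMap β)^[i] 1) * β ^ i ≤ (β * (betaMap β)^[i] 1) * β ^ i := by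
          gcongr; linarith
      _ = _ := by rw [pow_succ]; ring
  · intro i hi
    simp [iterate_betaMap_one_eq_zero hβ hi]
  · intro n hn
    rw [sum_antidiagonal_ncard_zeroFiber hβ n,
      ← Finset.sum_subset (s₁ := Finset.range m) (Finset.range_subset_range.2 (by omega))
        (fun i _ hi => if_neg (by simpa using hi))]
    exact Finset.sum_congr rfl fun k hk => if_pos (Finset.mem_range.1 hk)

/-! ### Uniform asymptotics of the counting function -/

/-- Since `s = (⌊β s⌋ + T s) / β`, the linear function `L * s` obeys the same recursion as the
normalized count, so the errors do as well. -/
lemma abs_ncard_zeroFiber_succ_sub_le {β : ℝ} (hβ : 1 < β) (L : ℝ) (n : ℕ) {s : ℝ}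
    (hs0 : 0 ≤ s) (hs1 : s ≤ 1) :
    |(zeroFiber β (n + 1) s).ncard / β ^ (n + 1) - L * s| ≤
      |(zeroFiber β n 1).ncard / β ^ n - L| +
        |(zeroFiber β n (betaMap β s)).ncard / β ^ n - L * betaMap β s| / β := by
  have hβ0 : 0 < β := by linarith
  have hfl := floor_add_betaMap β s
  have hfr := betaMap_nonneg β s
  have hf0 : (0 : ℝ) ≤ ⌊β * s⌋ := by exact_mod_cast Int.floor_nonneg.2 (by positivity)
  have hf1 : (⌊β * s⌋ : ℝ) / β ≤ 1 := by
    rw [div_le_one hβ0]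
    nlinarith
  have key : (zeroFiber β (n + 1) s).ncard / β ^ (n + 1) - L * s =
      ⌊β * s⌋ / β * ((zeroFiber β n 1).ncard / β ^ n - L) +
        ((zeroFiber β n (betaMap β s)).ncard / β ^ n - L * betaMap β s) / β := by
    have hs : s = (⌊β * s⌋ + betaMap β s) / β := by rw [hfl]; field_simp
    rw [ncard_zeroFiber_succ hβ n hs0]
    conv_lhs => rw [mul_comm L s]; arg 2; rw [hs]
    rw [pow_succ]
    field_simp
    ring
  rw [key]
  refine (abs_add_le _ _).trans ?_
  rw [abs_mul, abs_of_nonneg (div_nonneg hf0 hβ0.le), abs_div _ β, abs_of_pos hβ0]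
  gcongr
  exact mul_le_of_le_one_left (abs_nonneg _) hf1

lemma eventually_abs_ncard_zeroFiber_sub_lt {β : ℝ} {m : ℕ} (hβ : IsSimpleParry β m) {ε : ℝ}
    (hε : 0 < ε) :
    ∀ᶠ n in atTop, ∀ s, 0 ≤ s → s ≤ 1 →
      |(zeroFiber β n s).ncard / β ^ n - density β m * s| < ε := by
  have hβ1 := hβ.one_lt
  have hβ0 : 0 < β := by linarith
  set L := density β m
  have hL : 0 < L := density_pos hβ
  have hβ' : 0 < β - 1 := by linarith
  -- `δ` is chosen so that `ε / 2` is the fixed point of the recursion `e ↦ δ + e / β`.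
  set δ : ℝ := ε / 2 * (β - 1) / β with hδ
  have hδ0 : 0 < δ := by positivity
  obtain ⟨N, hN⟩ := (Metric.tendsto_atTop.1 (tendsto_ncard_zeroFiber_one hβ)) δ hδ0
  simp only [Real.dist_eq] at hN
  set K : ℝ := (zeroFiber β N 1).ncard / β ^ N + L with hK
  have hbound : ∀ k s, 0 ≤ s → s ≤ 1 →
      |(zeroFiber β (N + k) s).ncard / β ^ (N + k) - L * s| ≤ K * (β⁻¹) ^ k + ε / 2 := by
    intro k
    induction k with
    | zero =>
      intro s hs0 hs1
      have h1 : ((zeroFiber β N s).ncard : ℝ) ≤ (zeroFiber β N 1).ncard := by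
        exact_mod_cast Set.ncard_le_ncard (zeroFiber_mono β N hs1)
          (finite_zeroFiber hβ1 N zero_le_one)
      have h2 : ((zeroFiber β N s).ncard : ℝ) / β ^ N ≤ (zeroFiber β N 1).ncard / β ^ N := by
        gcongr
      have h3 : 0 ≤ ((zeroFiber β N s).ncard : ℝ) / β ^ N := by positivity
      have h4 : 0 ≤ L * s := by positivity
      have h5 : L * s ≤ L := mul_le_of_le_one_right hL.le hs1
      simp only [add_zero, pow_zero, mul_one]
      rw [abs_le]
      constructor <;> linarith
    | succ k ih =>
      intro s hs0 hs1
      have h1 := abs_ncard_zeroFiber_succ_sub_le hβ1 L (N + k) hs0 hs1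
      have h2 := (hN (N + k) (by omega)).le
      have h3 := ih _ (betaMap_nonneg β s) (betaMap_lt_one β s).le
      have h4 : |(zeroFiber β (N + k) (betaMap β s)).ncard / β ^ (N + k) - L * betaMap β s| / β ≤
          (K * (β⁻¹) ^ k + ε / 2) / β := by gcongr
      have h5 : δ + (K * (β⁻¹) ^ k + ε / 2) / β = K * (β⁻¹) ^ (k + 1) + ε / 2 := by
        rw [hδ, pow_succ]
        field_simp
        ring
      rw [← add_assoc]
      linarith
  have hlim : Tendsto (fun k : ℕ => K * (β⁻¹) ^ k) atTop (𝓝 0) := by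
    have := (tendsto_pow_atTop_nhds_zero_of_lt_one (inv_nonneg.2 hβ0.le)
      (inv_lt_one_of_one_lt₀ hβ1)).const_mul K
    simpa using this
  obtain ⟨k₀, hk₀⟩ := eventually_atTop.1 (hlim.eventually_lt_const (half_pos hε))
  refine eventually_atTop.2 ⟨N + k₀, fun n hn s hs0 hs1 => ?_⟩
  obtain ⟨j, rfl⟩ := Nat.exists_eq_add_of_le hn
  have h1 := hbound (k₀ + j) s hs0 hs1
  have h2 := hk₀ (k₀ + j) (by omega)
  rw [add_assoc]
  linarith

/-! ### The counting function and the enumeration of the `β`-integers -/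

lemma nonnegBetaIntegers_inter_Iio {β y : ℝ} (hβ : 1 < β) {n : ℕ} (hn : y ≤ β ^ n) :
    nonnegBetaIntegers β ∩ Set.Iio y = (fun z => β ^ n * z) '' zeroFiber β n (y / β ^ n) := by
  have hβ0 : 0 < β := by linarith
  ext x
  simp only [zeroFiber, Set.mem_inter_iff, Set.mem_Iio, Set.mem_image, Set.mem_ofPred_eq]
  constructor
  · rintro ⟨hx, hxy⟩
    refine ⟨x / β ^ n, ⟨div_nonneg hx.1 (by positivity), by gcongr, ?_⟩, by field_simp⟩
    exact (mem_nonnegBetaIntegers_iff hβ hx.1 (hxy.trans_le hn)).1 hx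
  · rintro ⟨z, ⟨h0, h1, h2⟩, rfl⟩
    have hlt : β ^ n * z < y := by rwa [lt_div_iff₀' (by positivity)] at h1
    refine ⟨(mem_nonnegBetaIntegers_iff hβ (by positivity) (hlt.trans_le hn)).2 ?_, hlt⟩
    rwa [mul_div_cancel_left₀ _ (by positivity)]

lemma finite_nonnegBetaIntegers_inter_Iio {β : ℝ} (hβ : 1 < β) (y : ℝ) :
    (nonnegBetaIntegers β ∩ Set.Iio y).Finite := by
  rcases lt_or_ge y 0 with hy | hy
  · refine Set.finite_empty.subset ?_
    rintro x ⟨hx, hxy⟩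
    exact absurd (hx.1.trans_lt hxy) (not_lt.2 hy.le)
  · obtain ⟨n, hn⟩ := pow_unbounded_of_one_lt y hβ
    rw [nonnegBetaIntegers_inter_Iio hβ hn.le]
    exact (finite_zeroFiber hβ n (div_nonneg hy (pow_nonneg (by linarith) n))).image _

lemma pow_mem_nonnegBetaIntegers {β : ℝ} (hβ : 1 < β) (n : ℕ) :
    β ^ n ∈ nonnegBetaIntegers β := by
  have hβ0 : 0 < β := by linarith
  rw [mem_nonnegBetaIntegers_iff hβ (by positivity) (pow_lt_pow_right₀ hβ (Nat.lt_succ_self n)),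
    Function.iterate_succ_apply]
  have : betaMap β (β ^ n / β ^ (n + 1)) = 0 := by
    rw [betaMap, show β * (β ^ n / β ^ (n + 1)) = 1 by rw [pow_succ]; field_simp, Int.fract_one]
  rw [this, iterate_betaMap_zero]

lemma tendsto_ncard_nonnegBetaIntegers {β : ℝ} {m : ℕ} (hβ : IsSimpleParry β m) :
    Tendsto (fun y : ℝ => ((nonnegBetaIntegers β ∩ Set.Iio y).ncard : ℝ) / y) atTop
      (𝓝 (density β m)) := by
  have hβ1 := hβ.one_lt
  have hβ0 : 0 < β := by linarith
  rw [Metric.tendsto_atTop]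
  intro ε hε
  obtain ⟨N, hN⟩ := eventually_atTop.1
    (eventually_abs_ncard_zeroFiber_sub_lt hβ (show 0 < ε / β by positivity))
  refine ⟨β ^ N, fun y hy => ?_⟩
  have hy1 : 1 ≤ y := (one_le_pow₀ hβ1.le).trans hy
  -- Scaling by the least power of `β` above `y` keeps `s = y / β ^ (n + 1)` at least `1 / β`, so
  -- dividing the uniform error by `s` costs a factor of at most `β`.
  obtain ⟨n, hn, hn'⟩ := exists_nat_pow_near hy1 hβ1
  have hNn : N ≤ n + 1 := (pow_le_pow_iff_right₀ hβ1).1 (hy.trans hn'.le)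
  have hinj : Function.Injective fun z : ℝ => β ^ (n + 1) * z :=
    mul_right_injective₀ (by positivity)
  have hs1 : y / β ^ (n + 1) ≤ 1 := (div_le_one (by positivity)).2 hn'.le
  have h := hN (n + 1) hNn (y / β ^ (n + 1)) (by positivity) hs1
  rw [nonnegBetaIntegers_inter_Iio hβ1 hn'.le, Set.ncard_image_of_injective _ hinj, Real.dist_eq]
  set c : ℝ := ((zeroFiber β (n + 1) (y / β ^ (n + 1))).ncard : ℝ)
  have hy0 : 0 < y := by linarith
  have h1 : c / y - density β m =
      (c / β ^ (n + 1) - density β m * (y / β ^ (n + 1))) * (β ^ (n + 1) / y) := by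
    field_simp
  have h2 : β ^ (n + 1) / y ≤ β := by
    rw [div_le_iff₀ hy0, pow_succ']
    gcongr
  rw [h1, abs_mul, abs_of_pos (show 0 < β ^ (n + 1) / y by positivity)]
  calc _ ≤ |c / β ^ (n + 1) - density β m * (y / β ^ (n + 1))| * β := by gcongr
    _ < ε / β * β := by gcongr
    _ = ε := by field_simp

/-- The `β`-integers are locally finite, bounded below and unbounded above, hence order isomorphic
to `ℕ`. -/
lemma exists_isBetaIntegerEnumeration {β : ℝ} (hβ : 1 < β) :
    ∃ b : ℕ → ℝ, IsBetaIntegerEnumeration β b := by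
  let Z := nonnegBetaIntegers β
  let _ : LocallyFiniteOrder Z := LocallyFiniteOrder.ofFiniteIcc fun x y => by
    refine Set.Finite.of_finite_image (f := Subtype.val) ?_ Subtype.val_injective.injOn
    refine (finite_nonnegBetaIntegers_inter_Iio hβ (y + 1)).subset ?_
    rintro _ ⟨z, hz, rfl⟩
    refine ⟨z.2, ?_⟩
    have : (z : ℝ) ≤ y := hz.2
    exact this.trans_lt (lt_add_one _)
  let _ : OrderBot Z :=
    { bot := ⟨0, zero_mem_nonnegBetaIntegers β⟩
      bot_le := fun z => z.2.1 }
  have : NoMaxOrder Z := ⟨fun z => by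
    obtain ⟨n, hn⟩ := pow_unbounded_of_one_lt (z : ℝ) hβ
    exact ⟨⟨β ^ n, pow_mem_nonnegBetaIntegers hβ n⟩, hn⟩⟩
  let _ : SuccOrder Z := LinearLocallyFiniteOrder.succOrder Z
  let _ : PredOrder Z := LinearLocallyFiniteOrder.predOrder Z
  let e : Z ≃o ℕ := orderIsoNatOfLinearSuccPredArch
  refine ⟨fun n => (e.symm n : ℝ), ⟨fun i j hij => ?_, ?_, ?_⟩⟩
  · exact e.symm.strictMono hij
  · have : e.symm 0 = (⊥ : Z) := e.symm.map_bot
    simp only [this]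
    rfl
  · ext x
    constructor
    · rintro ⟨n, rfl⟩
      exact (e.symm n).2
    · intro hx
      exact ⟨e ⟨x, hx⟩, by simp⟩

lemma IsBetaIntegerEnumeration.tendsto_atTop {β : ℝ} {b : ℕ → ℝ} (hβ : 1 < β)
    (hb : IsBetaIntegerEnumeration β b) : Tendsto b atTop atTop := by
  refine tendsto_atTop_atTop_of_monotone hb.strictMono.monotone fun y => ?_
  obtain ⟨n, hn⟩ := pow_unbounded_of_one_lt y hβ
  have := pow_mem_nonnegBetaIntegers hβ n
  rw [← hb.range_eq] at this
  obtain ⟨k, hk⟩ := this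
  exact ⟨k, by rw [hk]; exact hn.le⟩

lemma IsBetaIntegerEnumeration.ncard_inter_Iio {β : ℝ} {b : ℕ → ℝ}
    (hb : IsBetaIntegerEnumeration β b) (n : ℕ) :
    (nonnegBetaIntegers β ∩ Set.Iio (b n)).ncard = n := by
  have : nonnegBetaIntegers β ∩ Set.Iio (b n) = b '' Set.Iio n := by
    rw [← hb.range_eq]
    ext x
    constructor
    · rintro ⟨⟨k, rfl⟩, hk⟩
      exact ⟨k, hb.strictMono.lt_iff_lt.1 hk, rfl⟩
    · rintro ⟨k, hk, rfl⟩
      exact ⟨⟨k, rfl⟩, hb.strictMono hk⟩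
  rw [this, Set.ncard_image_of_injective _ hb.strictMono.injective, ← Finset.coe_Iio,
    Set.ncard_coe_finset, Nat.card_Iio]

end BetaNum

theorem mainTheorem1 (β : ℝ) (m : ℕ) (hβ : BetaNum.IsSimpleParry β m) :
    (∃ b : ℕ → ℝ, BetaNum.IsBetaIntegerEnumeration β b) ∧
    ∀ b : ℕ → ℝ, BetaNum.IsBetaIntegerEnumeration β b →
      Tendsto (fun n : ℕ => b n / (n : ℝ)) atTop
        (𝓝 ((β - 1) / (β ^ m - 1) *
          Polynomial.aeval β (Polynomial.derivative (BetaNum.parryPoly β m)))) := by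
  refine ⟨BetaNum.exists_isBetaIntegerEnumeration hβ.one_lt, fun b hb => ?_⟩
  rw [← BetaNum.inv_density hβ]
  refine (((BetaNum.tendsto_ncard_nonnegBetaIntegers hβ).comp
    (hb.tendsto_atTop hβ.one_lt)).inv₀ (BetaNum.density_pos hβ).ne').congr fun n => ?_
  rw [Function.comp_apply, hb.ncard_inter_Iio, inv_div]
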